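/- For a lattice $\Lambda\subset\mathbb C$ let $\mathbb P^1_{2,2,2,2}(\Lambda)=[E_\Lambda/\mathbb Z_2]$ be the complex orbifold quotient of $E_\Lambda=\mathbb C/\Lambda$ by $z\mapsto -z$, let $[w]$ denote the image of $w\in\mathbb C$ in it, and let $\Lambda_0=\mathbb Z+\mathbb Z\sqrt{-1}$. The orbifold points of $\mathbb P^1_{2,2,2,2}(\Lambda_0)$ are $x_1=[0]$, $x_2=[\tfrac12]$, $x_3=[\tfrac{1+\sqrt{-1}}2]$, $x_4=[\tfrac{\sqrt{-1}}2]$. For $d\ge 1$ and $i,j,k,l\in\{1,2,3,4\}$ let $\widetilde{\mathcal M}_{0,4,d}(\Delta_i,\Delta_j,\Delta_k,\Delta_l)$ be the collection of all pairs $\big(u:\mathbb P^1_{2,2,2,2}(\Lambda)\to\mathbb P^1_{2,2,2,2}(\Lambda_0),\,(z_1,z_2,z_3,z_4)\big)$, where $\Lambda\subset\mathbb C$ is any lattice, such that: $u$ is a holomorphic map of orbifolds of degree $d$ (as a map of spheres); $\{z_1,z_2,z_3,z_4\}=[\tfrac12\Lambda]$ and $z_1=[0]$; $u$ maps $(z_1,z_2,z_3,z_4)$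 to $(x_i,x_j,x_k,x_l)$; and near each $z_m$ the map $u$ is, in suitable uniformizing charts, the map $\mathbb C/\mathbb Z_2\to\mathbb C/\mathbb Z_2$ induced by the identity of $\mathbb C$. Two such pairs $(u,(z_m))$ and $(u',(z'_m))$ are equivalent if there is a biholomorphism $\phi$ of orbifolds between their domains with $u=u'\circ\phi$ and $\phi(z_m)=z'_m$ for all $m$. Let $\mathcal M_{0,4,d}(\Delta_i,\Delta_j,\Delta_k,\Delta_l)$ be the set of equivalence classes, and $\mathcal M_{0,4,d}(1)=\bigcup_{j,k,l}\mathcal M_{0,4,d}(\Delta_1,\Delta_j,\Delta_k,\Delta_l)$. Let $\mathcal L_d(\Lambda_0)$ be the set of two-dimensional (rank $2$) sublattices of $\Lambda_0$ of index $d$, and $\sigma_1(d)=\sum_{k\mid d}k$. **Theorem.** For every $d\ge1$ the sets $\mathcal M_{0,4,d}(1)$ and $\mathcal L_d(\Lambda_0)$ are finite, and, as formal power series in $q$, $$\sum_{d\ge1}|\mathcal M_{0,4,d}(1)|\,q^d \;=\; 6\sum_{d\ge1}|\mathcal L_d(\Lambda_0)|\,q^d \;=\; 6\sum_{d\ge1}\sigma_1(d)\,q^d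 \;=\; 6\sum_{n\ge1}\frac{n\,q^n}{1-q^n}.$$ Equivalently, for every $d\ge1$ the number $|\mathcal M_{0,4,d}(1)|$ is six times the (finite) number of integer solutions $(\alpha,\beta,\gamma,\delta)$ of $\alpha\delta-\beta\gamma=d$ modulo $SL(2,\mathbb Z)$, where $SL(2,\mathbb Z)$ acts on the matrices $\begin{pmatrix}\alpha&\gamma\\ \beta&\delta\end{pmatrix}$ by multiplication on the right. -/

import Mathlib

open scoped PowerSeries.WithPiTopology

namespace OrbiSphere

/-! ### The orbifolds `ℙ¹_{2,2,2,2}(Λ) = [E_Λ / ℤ₂]` -/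

/-- The elliptic curve `E_Λ = ℂ / Λ`. -/
abbrev Torus (Λ : Submodule ℤ ℂ) : Type := ℂ ⧸ Λ

/-- The underlying point set of `ℙ¹_{2,2,2,2}(Λ) = [E_Λ / ℤ₂]`: the orbits of `ℤ₂ = {1, -1}` acting
on `E_Λ` by `z ↦ ± z`.  Its complex orbifold structure is carried by the orbifold universal cover
`proj Λ : ℂ → ℙ¹_{2,2,2,2}(Λ)`, through the uniformizing charts `(U, Γ_z)` where `U` is an open
neighbourhood of a point `z : ℂ` invariant under the isotropy group `Γ_z` (see `isotropy`). -/
abbrev Pillow (Λ : Submodule ℤ ℂ) : Type := MulAction.orbitRel.Quotient ℤˣ (Torus Λ)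

/-- The orbifold universal covering `ℂ → E_Λ → [E_Λ / ℤ₂]`. -/
def proj (Λ : Submodule ℤ ℂ) (w : ℂ) : Pillow Λ :=
  Quotient.mk (MulAction.orbitRel ℤˣ (Torus Λ)) (Submodule.Quotient.mk w)

/-- The deck group `Λ ⋊ {1, -1}` of the universal covering, made of the maps `w ↦ ± w + v`
with `v ∈ Λ`. -/
def deckGroup (Λ : Submodule ℤ ℂ) : Subgroup (Equiv.Perm ℂ) where
  carrier := {g | ∃ ε : ℤˣ, ∃ v ∈ Λ, ∀ w, g w = (ε : ℤ) • w + v}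
  one_mem' := ⟨1, 0, Λ.zero_mem, fun w => by simp⟩
  mul_mem' := by
    rintro g h ⟨ε, v, hv, hg⟩ ⟨δ, v', hv', hh⟩
    refine ⟨ε * δ, (ε : ℤ) • v' + v, Λ.add_mem (Λ.smul_mem _ hv') hv, fun w => ?_⟩
    rw [Equiv.Perm.mul_apply, hh, hg, smul_add, smul_smul, Units.val_mul, add_assoc]
  inv_mem' := by
    rintro g ⟨ε, v, hv, hg⟩
    refine ⟨ε, -((ε : ℤ) • v), Λ.neg_mem (Λ.smul_mem _ hv), fun w => ?_⟩
    have hε : (ε : ℤ) * (ε : ℤ) = 1 := by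
      rw [← Units.val_mul, Int.units_mul_self, Units.val_one]
    rw [Equiv.Perm.inv_eq_iff_eq, hg, smul_add, smul_neg, smul_smul, smul_smul, hε]
    simp

/-- The isotropy group of the point `z` of the universal cover: trivial unless `2 z ∈ Λ`, in which
case it is `{id, w ↦ 2 z - w} ≅ ℤ₂`. -/
abbrev isotropy (Λ : Submodule ℤ ℂ) (z : ℂ) : Subgroup (deckGroup Λ) :=
  MulAction.stabilizer (deckGroup Λ) z

/-! ### Holomorphic orbi-maps -/

/-- A local holomorphic lifting at `z` of a map `u : ℙ¹_{2,2,2,2}(Λ) → ℙ¹_{2,2,2,2}(Λ')`: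
a holomorphic map `f` on a `Γ_z`-invariant open neighbourhood `U` of `z` that covers `u`, and is
equivariant with respect to a homomorphism `ρ : Γ_z → Γ'_{f z}` of isotropy groups. -/
structure LocalLift {Λ Λ' : Submodule ℤ ℂ} (u : Pillow Λ → Pillow Λ') (z : ℂ) where
  U : Set ℂ
  isOpen : IsOpen U
  mem : z ∈ U
  invariant : ∀ g : isotropy Λ z, ∀ w ∈ U, g • w ∈ U
  f : ℂ → ℂ
  holo : DifferentiableOn ℂ f U
  covers : ∀ w ∈ U, proj Λ' (f w) = u (proj Λ w)
  ρ : isotropy Λ z →* isotropy Λ' (f z)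
  equivariant : ∀ g : isotropy Λ z, ∀ w ∈ U, f (g • w) = ρ g • f w

/-- The local lifting is, in suitable uniformizing charts, the map
`ℂ / ℤ₂ → ℂ / ℤ₂` induced by the identity `ℂ → ℂ`: it is biholomorphic onto its image, and
the homomorphism of isotropy groups is an isomorphism. -/
def LocalLift.IsIdInCharts {Λ Λ' : Submodule ℤ ℂ} {u : Pillow Λ → Pillow Λ'} {z : ℂ}
    (F : LocalLift u z) : Prop :=
  Set.InjOn F.f F.U ∧ Function.Bijective F.ρ

/-- `u` is a holomorphic map of orbifolds: it has a local holomorphic lifting at every point.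
(Continuity of `u` is a consequence.) -/
def IsHolomorphicOrbiMap {Λ Λ' : Submodule ℤ ℂ} (u : Pillow Λ → Pillow Λ') : Prop :=
  ∀ z : ℂ, Nonempty (LocalLift u z)

/-- The degree of a holomorphic map between spheres: `deg u = d` when all but finitely many
points of the target have exactly `d` preimages. -/
def HasDegree {Λ Λ' : Submodule ℤ ℂ} (u : Pillow Λ → Pillow Λ') (d : ℕ) : Prop :=
  {y : Pillow Λ' | (u ⁻¹' {y}).encard ≠ (d : ℕ∞)}.Finite

/-- `φ` is a biholomorphism of orbifolds. -/
def IsBiholomorphism {Λ Λ' : Submodule ℤ ℂ} (φ : Pillow Λ ≃ Pillow Λ') : Prop :=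
  IsHolomorphicOrbiMap φ ∧ IsHolomorphicOrbiMap φ.symm

theorem isHolomorphicOrbiMap_id (Λ : Submodule ℤ ℂ) :
    IsHolomorphicOrbiMap (id : Pillow Λ → Pillow Λ) := fun z =>
  ⟨{ U := Set.univ
     isOpen := isOpen_univ
     mem := Set.mem_univ z
     invariant := fun _ _ _ => Set.mem_univ _
     f := id
     holo := differentiableOn_id
     covers := fun _ _ => rfl
     ρ := MonoidHom.id _
     equivariant := fun _ _ _ => rfl }⟩

theorem IsHolomorphicOrbiMap.comp {Λ Λ' Λ'' : Submodule ℤ ℂ} {v : Pillow Λ' → Pillow Λ''}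
    {u : Pillow Λ → Pillow Λ'} (hv : IsHolomorphicOrbiMap v) (hu : IsHolomorphicOrbiMap u) :
    IsHolomorphicOrbiMap (v ∘ u) := by
  intro z
  obtain ⟨F⟩ := hu z
  obtain ⟨G⟩ := hv (F.f z)
  exact
    ⟨{ U := F.U ∩ F.f ⁻¹' G.U
       isOpen := F.holo.continuousOn.isOpen_inter_preimage F.isOpen G.isOpen
       mem := ⟨F.mem, G.mem⟩
       invariant := fun g w hw => ⟨F.invariant g w hw.1, by
         rw [Set.mem_preimage, F.equivariant g w hw.1]
         exact G.invariant _ _ hw.2⟩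
       f := G.f ∘ F.f
       holo := G.holo.comp (F.holo.mono Set.inter_subset_left) fun _ hw => hw.2
       covers := fun w hw => by
         rw [Function.comp_apply, Function.comp_apply, G.covers _ hw.2, F.covers _ hw.1]
       ρ := G.ρ.comp F.ρ
       equivariant := fun g w hw => by
         rw [Function.comp_apply, F.equivariant g w hw.1, G.equivariant _ _ hw.2]
         rfl }⟩

/-! ### The target and the moduli spaces -/

/-- The standard lattice `Λ₀ = ℤ + ℤ √-1`. -/
def stdLattice : Submodule ℤ ℂ := Submodule.span ℤ {1, Complex.I}

/-- The orbifold points `x₁, x₂, x₃, x₄` of the target `ℙ¹_{2,2,2,2}(Λ₀)`: the classes of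
`0`, `1/2`, `(1 + √-1)/2` and `√-1/2`. -/
noncomputable def x : Fin 4 → Pillow stdLattice :=
  ![proj stdLattice 0, proj stdLattice (1 / 2), proj stdLattice ((1 + Complex.I) / 2),
    proj stdLattice (Complex.I / 2)]

/-- A lattice in `ℂ`, i.e. a discrete subgroup that spans `ℂ` over `ℝ`. -/
structure ComplexLattice where
  Λ : Submodule ℤ ℂ
  [discrete : DiscreteTopology Λ]
  [isZLattice : IsZLattice ℝ Λ]

/-- A map `ℙ¹_{2,2,2,2}(Λ) → ℙ¹_{2,2,2,2}(Λ₀)`, for any lattice `Λ ⊂ ℂ`, with four points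
`z₁, z₂, z₃, z₄` of the domain. -/
structure MarkedMap where
  L : ComplexLattice
  u : Pillow L.Λ → Pillow stdLattice
  z : Fin 4 → Pillow L.Λ

/-- Equivalence of marked maps: `u = u' ∘ φ` and `φ (z_i) = z'_i` for a biholomorphism `φ`
between the domains. -/
instance MarkedMap.setoid : Setoid MarkedMap where
  r A B := ∃ φ : Pillow A.L.Λ ≃ Pillow B.L.Λ,
    IsBiholomorphism φ ∧ A.u = B.u ∘ φ ∧ ∀ i, φ (A.z i) = B.z i
  iseqv :=
    { refl := fun A => ⟨Equiv.refl _,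
        ⟨isHolomorphicOrbiMap_id _, isHolomorphicOrbiMap_id _⟩, rfl, fun _ => rfl⟩
      symm := by
        rintro A B ⟨φ, hφ, hu, hz⟩
        refine ⟨φ.symm, ⟨hφ.2, hφ.1⟩, ?_, fun i => ?_⟩
        · rw [hu, Function.comp_assoc, Equiv.self_comp_symm, Function.comp_id]
        · rw [← hz i, Equiv.symm_apply_apply]
      trans := by
        rintro A B C ⟨φ, hφ, hu, hz⟩ ⟨ψ, hψ, hv, hw⟩
        refine ⟨φ.trans ψ, ⟨hψ.1.comp hφ.1, hφ.2.comp hψ.2⟩, ?_, fun i => ?_⟩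
        · rw [hu, hv, Function.comp_assoc, Equiv.coe_trans]
        · rw [Equiv.trans_apply, hz, hw] }

/-- The set of degree `d` holomorphic orbi-spheres of type `(a₁, a₂, a₃, a₄)`: the marked maps
with `u` holomorphic of degree `d`, `{z₁, z₂, z₃, z₄} = [½ Λ]`, `z₁ = [0]`, `u (z_i) = x_{a_i}`, and
local lifting at each `z_i` given by the identity. -/
def orbiSpheres (d : ℕ) (a : Fin 4 → Fin 4) : Set MarkedMap :=
  {A | IsHolomorphicOrbiMap A.u ∧ HasDegree A.u d ∧
    Set.range A.z = proj A.L.Λ '' {w | 2 * w ∈ A.L.Λ} ∧ A.z 0 = proj A.L.Λ 0 ∧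
    (∀ i, A.u (A.z i) = x (a i)) ∧
    ∀ i, ∀ w, proj A.L.Λ w = A.z i → ∃ F : LocalLift A.u w, F.IsIdInCharts}

/-- The moduli space `𝓜_{0,4,d}(Δ_{a₁}, Δ_{a₂}, Δ_{a₃}, Δ_{a₄})` of equivalence classes. -/
def moduli (d : ℕ) (a : Fin 4 → Fin 4) : Set (Quotient MarkedMap.setoid) :=
  Quotient.mk MarkedMap.setoid '' orbiSpheres d a

/-- `𝓜_{0,4,d}(1) = ⋃_{j,k,l} 𝓜_{0,4,d}(Δ₁, Δ_j, Δ_k, Δ_l)`. -/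
def moduliOne (d : ℕ) : Set (Quotient MarkedMap.setoid) :=
  ⋃ (j : Fin 4) (k : Fin 4) (l : Fin 4), moduli d ![0, j, k, l]

/-! ### Sublattices, the determinant equation and generating series -/

/-- `𝓛_d(Λ₀)`: the two-dimensional sublattices of `Λ₀` of index `d`. -/
def sublattices (d : ℕ) : Set (Submodule ℤ ℂ) :=
  {Λ | Λ ≤ stdLattice ∧ Module.finrank ℤ Λ = 2 ∧
    Nat.card (stdLattice ⧸ Λ.submoduleOf stdLattice) = d}

/-- The integer solutions of `α δ - β γ = d`, written as the matrices with columns `(α, β)` and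
`(γ, δ)`. -/
def DetSolution (d : ℕ) : Type :=
  {A : Matrix (Fin 2) (Fin 2) ℤ // A 0 0 * A 1 1 - A 1 0 * A 0 1 = (d : ℤ)}

/-- Two solutions are equivalent when an element of `SL(2, ℤ)` acting linearly on the pair of columns
takes one to the other. -/
def DetSolution.setoid (d : ℕ) : Setoid (DetSolution d) where
  r A B := ∃ g : Matrix.SpecialLinearGroup (Fin 2) ℤ, B.1 = A.1 * g.1
  iseqv :=
    { refl := fun A => ⟨1, by simp⟩
      symm := by
        rintro A B ⟨g, h⟩
        refine ⟨g⁻¹, ?_⟩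
        rw [h, Matrix.mul_assoc, ← Matrix.SpecialLinearGroup.coe_mul, mul_inv_cancel]
        simp
      trans := by
        rintro A B C ⟨g, h⟩ ⟨k, h'⟩
        exact ⟨g * k, by rw [h', h, Matrix.mul_assoc, Matrix.SpecialLinearGroup.coe_mul]⟩ }

/-- The solutions of the determinant equation modulo `SL(2, ℤ)`. -/
abbrev DetClasses (d : ℕ) : Type := Quotient (DetSolution.setoid d)

/-- The formal power series `∑_{d ≥ 1} a_d q^d`. -/
noncomputable def genSeries (a : ℕ → ℕ) : PowerSeries ℚ :=
  PowerSeries.mk fun d => if d = 0 then 0 else (a d : ℚ)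

end OrbiSphere

/-! Two local liftings of an orbi-map differ by a sign and a translation by the target lattice, so
the square of the derivative of a lifting does not depend on the lifting. It is therefore an entire
function on the universal cover, periodic under `Λ`, hence constant by Liouville. So the map is
induced by some `w ↦ c w + b` (`IsHolomorphicOrbiMap.exists_affine`).

Since `[0]` goes to `x₁ = [0]`, the translation `b` lies in `Λ₀` and can be dropped; positive degree
gives `c ≠ 0`. Rescaling the domain by `c` turns `Λ` into the sublattice `c Λ` of `Λ₀` and the map
into the one induced by the identity (`exists_equiv_sphere`). A generic fibre is then a copy of `Λ₀
/ c Λ`, so degree means index (`hasDegree_iff`). An equivalence between two normalized maps comes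
from `w ↦ ± w`, which is trivial on the quotient (`sphere_injective`). What remains is a sublattice
of index `d` and an ordering of its three nonzero half-points, whence the factor `3! = 6`.

Sublattices of index `d` are column spans of integer matrices of determinant `d`, up to `SL(2, ℤ)`
on the right (`latticeOf_eq_iff`). Hermite normal forms represent each class once, and there are
`σ₁(d)` of them (`card_detClasses`). The Lambert series follows by comparing coefficients. -/

namespace OrbiSphere

/-! ### Column spans of integer matrices -/

section ColumnSpan

open Matrix

variable {M : Type*} [AddCommGroup M] (b : Module.Basis (Fin 2) ℤ M)

theorem range_toLin_mul_specialLinearGroup (A : Matrix (Fin 2) (Fin 2) ℤ)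
    (g : SpecialLinearGroup (Fin 2) ℤ) :
    LinearMap.range (toLin b b (A * g.1)) = LinearMap.range (toLin b b A) := by
  rw [toLin_mul b b b, LinearMap.range_comp_of_range_eq_top]
  refine LinearMap.range_eq_top.2 fun y => ⟨toLin b b (g⁻¹).1 y, ?_⟩
  have hg : g.1 * (g⁻¹).1 = 1 := congrArg Subtype.val (mul_inv_cancel g)
  rw [← LinearMap.comp_apply, ← toLin_mul b b b, hg, toLin_one, LinearMap.id_apply]

theorem exists_eq_mul_of_range_toLin_le {A B : Matrix (Fin 2) (Fin 2) ℤ}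
    (h : LinearMap.range (toLin b b B) ≤ LinearMap.range (toLin b b A)) :
    ∃ G : Matrix (Fin 2) (Fin 2) ℤ, B = A * G := by
  choose y hy using fun j => h ⟨b j, rfl⟩
  refine ⟨LinearMap.toMatrix b b (b.constr ℤ y), (toLin b b).injective ?_⟩
  rw [toLin_mul b b b, toLin_toMatrix]
  refine b.ext fun j => ?_
  rw [LinearMap.comp_apply, Module.Basis.constr_basis, hy]

theorem toLin_injective_of_det_ne_zero {A : Matrix (Fin 2) (Fin 2) ℤ} (hA : A.det ≠ 0) :
    Function.Injective (toLin b b A) := by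
  refine (injective_iff_map_eq_zero _).2 fun v hv => ?_
  -- The adjugate turns `A v = 0` into `det A • v = 0`, and a free module has no torsion.
  have h : toLin b b (A.adjugate * A) v = 0 := by
    rw [toLin_mul b b b, LinearMap.comp_apply, hv, map_zero]
  rw [adjugate_mul, map_smul, toLin_one, LinearMap.smul_apply, LinearMap.id_apply] at h
  have := Module.Free.of_basis b
  exact (smul_eq_zero.1 h).resolve_left hA

theorem card_quotient_range_toLin {A : Matrix (Fin 2) (Fin 2) ℤ} (hA : A.det ≠ 0) :
    Nat.card (M ⧸ LinearMap.range (toLin b b A)) = A.det.natAbs := by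
  have := Module.Free.of_basis b
  have := Module.Finite.of_basis b
  rw [← Submodule.natAbs_det_equiv _
    (LinearEquiv.ofInjective (toLin b b A) (toLin_injective_of_det_ne_zero b hA)),
    ← LinearMap.det_toLin b A]
  rfl

theorem finrank_range_toLin {A : Matrix (Fin 2) (Fin 2) ℤ} (hA : A.det ≠ 0) :
    Module.finrank ℤ (LinearMap.range (toLin b b A)) = 2 := by
  rw [LinearMap.finrank_range_of_inj (toLin_injective_of_det_ne_zero b hA),
    Module.finrank_eq_card_basis b, Fintype.card_fin]

theorem exists_range_toLin_eq {d : ℕ} (N : Submodule ℤ M)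
    (hN : Module.finrank ℤ N = 2) (hc : Nat.card (M ⧸ N) = d) :
    ∃ A : Matrix (Fin 2) (Fin 2) ℤ, A.det = d ∧ LinearMap.range (toLin b b A) = N := by
  have := Module.Free.of_basis b
  have := Module.Finite.of_basis b
  let bN : Module.Basis (Fin 2) ℤ N := Module.finBasisOfFinrankEq ℤ N hN
  let e : M ≃ₗ[ℤ] N := b.equiv bN (Equiv.refl _)
  obtain ⟨A, hA⟩ := (toLin b b).surjective (N.subtype ∘ₗ e.toLinearMap)
  have hr : LinearMap.range (toLin b b A) = N := by
    rw [hA, LinearMap.range_comp, LinearEquiv.range, Submodule.map_top, Submodule.range_subtype]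
  have hdet : A.det.natAbs = d := by
    rw [← hc, ← Submodule.natAbs_det_equiv N e, ← LinearMap.det_toLin b A, hA]
    rfl
  rcases Int.natAbs_eq A.det with h | h
  · exact ⟨A, by rw [h, hdet], hr⟩
  -- A determinant of the wrong sign is repaired by swapping the two columns, which keeps their
  -- span.
  · have hs : (!![0, 1; 1, 0] : Matrix (Fin 2) (Fin 2) ℤ) * !![0, 1; 1, 0] = 1 := by decide
    refine ⟨A * !![0, 1; 1, 0], ?_, ?_⟩
    · rw [det_mul, h, hdet, det_fin_two_of]
      ring
    · rw [toLin_mul b b b, LinearMap.range_comp_of_range_eq_top, hr]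
      refine LinearMap.range_eq_top.2 fun y => ⟨toLin b b !![0, 1; 1, 0] y, ?_⟩
      rw [← LinearMap.comp_apply, ← toLin_mul b b b, hs, toLin_one, LinearMap.id_apply]

end ColumnSpan

/-! ### Sublattices of the standard lattice -/

theorem stdLattice_eq : stdLattice = Submodule.span ℤ (Set.range Complex.basisOneI) := by
  rw [stdLattice, Complex.coe_basisOneI, Matrix.range_cons, Matrix.range_cons,
    Matrix.range_empty, Set.union_empty]
  rfl

noncomputable def stdBasis : Module.Basis (Fin 2) ℤ stdLattice :=
  (Complex.basisOneI.restrictScalars ℤ).map (LinearEquiv.ofEq _ _ stdLattice_eq.symm)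

theorem DetSolution.det_eq {d : ℕ} (A : DetSolution d) : A.1.det = d := by
  have := A.2
  rw [Matrix.det_fin_two]
  linarith

/-- The sublattice of `ℤ + ℤ i` spanned by the columns of `A`. -/
noncomputable def latticeOf (A : Matrix (Fin 2) (Fin 2) ℤ) : Submodule ℤ ℂ :=
  (LinearMap.range (Matrix.toLin stdBasis stdBasis A)).map stdLattice.subtype

theorem submoduleOf_latticeOf (A : Matrix (Fin 2) (Fin 2) ℤ) :
    (latticeOf A).submoduleOf stdLattice =
      LinearMap.range (Matrix.toLin stdBasis stdBasis A) :=
  Submodule.comap_map_eq_of_injective stdLattice.injective_subtype _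

theorem latticeOf_mem_sublattices {d : ℕ} (hd : 1 ≤ d) (A : DetSolution d) :
    latticeOf A.1 ∈ sublattices d := by
  have hA : A.1.det ≠ 0 := by rw [A.det_eq]; exact_mod_cast (by omega : d ≠ 0)
  refine ⟨Submodule.map_subtype_le _ _, ?_, ?_⟩
  · rw [latticeOf, Submodule.finrank_map_subtype_eq, finrank_range_toLin _ hA]
  · rw [submoduleOf_latticeOf, card_quotient_range_toLin _ hA, A.det_eq, Int.natAbs_natCast]

theorem exists_latticeOf_eq {d : ℕ} {Λ : Submodule ℤ ℂ} (h : Λ ∈ sublattices d) :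
    ∃ A : DetSolution d, latticeOf A.1 = Λ := by
  obtain ⟨hle, hr, hc⟩ := h
  obtain ⟨A, hA, hN⟩ := exists_range_toLin_eq stdBasis (Λ.submoduleOf stdLattice)
    ((Submodule.submoduleOfEquivOfLe hle).finrank_eq.trans hr) hc
  refine ⟨⟨A, by rw [← hA, Matrix.det_fin_two, mul_comm (A 0 1)]⟩, ?_⟩
  rw [latticeOf, hN, Submodule.submoduleOf, Submodule.map_comap_subtype, inf_eq_right]
  exact hle

/-- Inclusion of spans gives `B = A * G` over `ℤ`. Both determinants equal `d ≠ 0`, with sign, so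
`det G = 1`. -/
theorem latticeOf_eq_iff {d : ℕ} (hd : 1 ≤ d) (A B : DetSolution d) :
    latticeOf A.1 = latticeOf B.1 ↔ DetSolution.setoid d A B := by
  have hd' : (d : ℤ) ≠ 0 := by exact_mod_cast (by omega : d ≠ 0)
  constructor
  · intro h
    have h' := Submodule.map_injective_of_injective stdLattice.injective_subtype h
    obtain ⟨G, hG⟩ := exists_eq_mul_of_range_toLin_le stdBasis h'.ge
    have hdet := congrArg Matrix.det hG
    rw [Matrix.det_mul, A.det_eq, B.det_eq] at hdet
    exact ⟨⟨G, mul_left_cancel₀ hd' (by rw [← hdet, mul_one])⟩, hG⟩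
  · rintro ⟨g, hg⟩
    rw [latticeOf, latticeOf, hg, range_toLin_mul_specialLinearGroup]

/-- Sending a solution of the determinant equation to the lattice spanned by its columns. -/
noncomputable def detClassesEquiv {d : ℕ} (hd : 1 ≤ d) : DetClasses d ≃ sublattices d :=
  Equiv.ofBijective
    (Quotient.lift (s := DetSolution.setoid d)
      (fun A => ⟨latticeOf A.1, latticeOf_mem_sublattices hd A⟩)
      fun A B h => Subtype.ext ((latticeOf_eq_iff hd A B).2 h))
    ⟨by
      rintro ⟨A⟩ ⟨B⟩ h
      exact Quotient.sound ((latticeOf_eq_iff hd A B).1 (congrArg Subtype.val h)), by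
      rintro ⟨Λ, hΛ⟩
      obtain ⟨A, hA⟩ := exists_latticeOf_eq hΛ
      exact ⟨Quotient.mk _ A, Subtype.ext hA⟩⟩

/-! ### Counting classes of solutions by Hermite normal forms -/

/-- The Hermite normal form `(a, b; 0, e)` with `a e = d` and `0 ≤ b < a`. -/
def hermite {d : ℕ} (p : Σ x : d.divisorsAntidiagonal, Fin x.1.1) : DetSolution d :=
  ⟨!![(p.1.1.1 : ℤ), (p.2 : ℕ); 0, (p.1.1.2 : ℤ)], by
    have := (Nat.mem_divisorsAntidiagonal.1 p.1.2).1
    simp only [Matrix.of_apply, Matrix.cons_val_zero, Matrix.cons_val_one, Matrix.cons_val',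
      Matrix.cons_val_fin_one, zero_mul, sub_zero]
    exact_mod_cast this⟩

/-- The zeros at the lower left make `g` upper triangular, and positivity of the diagonals makes its
diagonal `1`. Then `b'` and `b` agree modulo `a`, and both lie in `[0, a)`. -/
theorem hermite_injective {d : ℕ} (hd : 1 ≤ d) :
    Function.Injective fun p : Σ x : d.divisorsAntidiagonal, Fin x.1.1 =>
      (Quotient.mk (DetSolution.setoid d) (hermite p)) := by
  rintro ⟨⟨⟨a, e⟩, h⟩, b, hb⟩ ⟨⟨⟨a', e'⟩, h'⟩, b', hb'⟩ hp
  obtain ⟨g, hg⟩ := Quotient.exact hp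
  have h1 := (Nat.mem_divisorsAntidiagonal.1 h).1
  have h1' := (Nat.mem_divisorsAntidiagonal.1 h').1
  dsimp only at h1 h1' hb hb'
  have ha : 0 < a := by rcases Nat.eq_zero_or_pos a with rfl | h <;> omega
  have he : 0 < e := by rcases Nat.eq_zero_or_pos e with rfl | h <;> omega
  have he' : 0 < e' := by rcases Nat.eq_zero_or_pos e' with rfl | h <;> omega
  have hdet := g.2
  rw [Matrix.det_fin_two] at hdet
  have e00 := congrFun (congrFun hg 0) 0
  have e01 := congrFun (congrFun hg 0) 1
  have e10 := congrFun (congrFun hg 1) 0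
  have e11 := congrFun (congrFun hg 1) 1
  simp only [hermite, Matrix.mul_apply, Fin.sum_univ_two, Matrix.of_apply, Matrix.cons_val_zero,
    Matrix.cons_val_one, Matrix.cons_val', Matrix.cons_val_fin_one, zero_mul, zero_add]
    at e00 e01 e10 e11
  have g10 : g.1 1 0 = 0 := by
    rcases mul_eq_zero.1 e10.symm with h | h
    · omega
    · exact h
  rw [g10, mul_zero, sub_zero] at hdet
  have g11 : g.1 1 1 = 1 := by
    have : 0 < g.1 1 1 := by
      by_contra hn
      have : (e : ℤ) * g.1 1 1 ≤ 0 := mul_nonpos_of_nonneg_of_nonpos (by omega) (by omega)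
      omega
    rcases Int.isUnit_iff.1 (IsUnit.of_mul_eq_one _ (by rw [mul_comm]; exact hdet) :
      IsUnit (g.1 1 1)) with h | h <;> omega
  have g00 : g.1 0 0 = 1 := by rwa [g11, mul_one] at hdet
  rw [g00, g10, mul_one, mul_zero, add_zero] at e00
  rw [g11, mul_one] at e11 e01
  obtain rfl : a' = a := by exact_mod_cast e00
  obtain rfl : e' = e := by exact_mod_cast e11
  obtain rfl : b' = b := by
    have hm : ((b' : ℤ)) % a' = (b : ℤ) % a' := by rw [e01, Int.mul_add_emod_self_left]
    rwa [Int.emod_eq_of_lt (by omega) (by omega), Int.emod_eq_of_lt (by omega) (by omega),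
      Nat.cast_inj] at hm
  rfl

/-- Write the bottom row as `g (β', δ')` with `(β', δ')` primitive and take Bézout coefficients `x,
y`. The column operations `(δ', -β')` and `(x, y)` turn the bottom row into `(0, g)`; subtracting a
multiple of the first new column from the second reduces the upper right entry modulo `a`. -/
theorem hermite_surjective {d : ℕ} (hd : 1 ≤ d) :
    Function.Surjective fun p : Σ x : d.divisorsAntidiagonal, Fin x.1.1 =>
      (Quotient.mk (DetSolution.setoid d) (hermite p)) := by
  rintro ⟨A, hA⟩
  set α := A 0 0 with hα
  set γ := A 0 1 with hγ
  set β := A 1 0 with hβ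
  set δ := A 1 1 with hδ
  obtain ⟨g, β', δ', hg, hco, hβ', hδ'⟩ : ∃ (g : ℕ) (β' δ' : ℤ), 0 < g ∧ IsCoprime β' δ' ∧
      β = β' * g ∧ δ = δ' * g := by
    have : 0 < Int.gcd β δ := by
      refine Int.gcd_pos_iff.2 ?_
      by_contra! h
      rw [h.1, h.2] at hA
      simp only [mul_zero, zero_mul, sub_zero] at hA
      omega
    obtain ⟨g, β', δ', hg0, hg, h1, h2⟩ := Int.exists_gcd_one' this
    exact ⟨g, β', δ', hg0, Int.isCoprime_iff_gcd_eq_one.2 hg, h1, h2⟩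
  obtain ⟨x, y, hxy⟩ := hco
  set a : ℤ := α * δ' - β' * γ with ha
  have hag : a * g = d := by rw [← hA, ha, hβ', hδ']; ring
  have ha0 : 0 < a := by
    by_contra hn
    have := mul_nonpos_of_nonpos_of_nonneg (not_lt.1 hn) (by omega : (0 : ℤ) ≤ g)
    omega
  set c : ℤ := α * x + γ * y with hc
  lift a to ℕ using ha0.le with n hn
  have hb0 := Int.emod_nonneg c ha0.ne'
  have hb1 := Int.emod_lt_of_pos c ha0
  have hb2 := Int.mul_ediv_add_emod c n
  obtain ⟨m, hm⟩ := Int.eq_ofNat_of_zero_le hb0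
  refine ⟨⟨⟨(n, g), Nat.mem_divisorsAntidiagonal.2 ⟨by exact_mod_cast hag, by omega⟩⟩,
    ⟨m, by dsimp only; omega⟩⟩, ?_⟩
  refine (Quotient.sound (s := DetSolution.setoid d) (a := ⟨A, hA⟩) ?_).symm
  refine ⟨⟨!![δ', x - δ' * (c / n); -β', y + β' * (c / n)], ?_⟩, ?_⟩
  · rw [Matrix.det_fin_two_of]
    linear_combination hxy
  · ext i j
    fin_cases i <;> fin_cases j <;>
      simp [hermite, Matrix.mul_apply, Fin.sum_univ_two, ← hα, ← hβ, ← hγ, ← hδ]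
    · linear_combination ha
    · linear_combination -hc + hb2 - hm - (c / n) * ha
    · rw [hβ', hδ']; ring
    · rw [hβ', hδ']
      linear_combination (-(g : ℤ)) * hxy

theorem card_detClasses {d : ℕ} (hd : 1 ≤ d) :
    Finite (DetClasses d) ∧ Nat.card (DetClasses d) = ArithmeticFunction.sigma 1 d := by
  let e := Equiv.ofBijective _ ⟨hermite_injective hd, hermite_surjective hd⟩
  refine ⟨Finite.of_equiv _ e, ?_⟩
  -- A factorization `d = a e` contributes the `a` choices of `b`, so the total is the sum of the
  -- divisors `a`.
  rw [← Nat.card_congr e, Nat.card_sigma, ArithmeticFunction.sigma_one_apply,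
    ← Nat.sum_divisorsAntidiagonal (fun a _ => a)]
  simp_rw [Nat.card_fin]
  exact Finset.sum_coe_sort d.divisorsAntidiagonal Prod.fst

theorem finite_sublattices {d : ℕ} (hd : 1 ≤ d) : (sublattices d).Finite := by
  have := (card_detClasses hd).1
  exact Set.finite_coe_iff.1 (Finite.of_equiv _ (detClassesEquiv hd))

theorem ncard_sublattices {d : ℕ} (hd : 1 ≤ d) :
    (sublattices d).ncard = Nat.card (DetClasses d) :=
  (Nat.card_congr (detClassesEquiv hd)).symm

/-! ### The projection -/

theorem proj_eq_proj_iff {Λ : Submodule ℤ ℂ} {w w' : ℂ} :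
    proj Λ w = proj Λ w' ↔ w - w' ∈ Λ ∨ w + w' ∈ Λ := by
  rw [proj, proj, Quotient.eq, MulAction.orbitRel_apply, MulAction.mem_orbit_iff]
  constructor
  · rintro ⟨ε, h⟩
    rcases Int.units_eq_one_or ε with rfl | rfl
    · rw [one_smul, eq_comm, Submodule.Quotient.eq] at h
      exact Or.inl h
    · rw [Units.neg_smul, one_smul, ← Submodule.Quotient.mk_neg, eq_comm,
        Submodule.Quotient.eq, sub_neg_eq_add] at h
      exact Or.inr h
  · rintro (h | h)
    · exact ⟨1, by rw [one_smul, eq_comm, Submodule.Quotient.eq]; exact h⟩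
    · refine ⟨-1, ?_⟩
      rw [Units.neg_smul, one_smul, ← Submodule.Quotient.mk_neg, eq_comm,
        Submodule.Quotient.eq, sub_neg_eq_add]
      exact h

theorem proj_surjective (Λ : Submodule ℤ ℂ) : Function.Surjective (proj Λ) := by
  rintro ⟨⟨w⟩⟩
  exact ⟨w, rfl⟩

theorem proj_neg (Λ : Submodule ℤ ℂ) (w : ℂ) : proj Λ (-w) = proj Λ w :=
  proj_eq_proj_iff.2 (Or.inr (by rw [neg_add_cancel]; exact Λ.zero_mem))

theorem proj_add_of_mem {Λ : Submodule ℤ ℂ} {v : ℂ} (hv : v ∈ Λ) (w : ℂ) :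
    proj Λ (w + v) = proj Λ w :=
  proj_eq_proj_iff.2 (Or.inl (by rwa [add_sub_cancel_left]))

theorem proj_eq_proj_zero_iff {Λ : Submodule ℤ ℂ} {w : ℂ} : proj Λ w = proj Λ 0 ↔ w ∈ Λ := by
  rw [proj_eq_proj_iff, sub_zero, add_zero, or_self]

/-! ### Two liftings of the same map differ by a sign in their derivative -/

theorem isClosed_of_discreteTopology (Λ : Submodule ℤ ℂ) [DiscreteTopology Λ] :
    IsClosed (Λ : Set ℂ) := by
  have : DiscreteTopology Λ.toAddSubgroup := inferInstanceAs (DiscreteTopology Λ)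
  exact AddSubgroup.isClosed_of_discrete (H := Λ.toAddSubgroup)

/-- A function that is continuous at `z` and takes values in a discrete subgroup near `z`
is constant near `z`. -/
theorem eventually_eq_of_eventually_mem {Λ : Submodule ℤ ℂ} [DiscreteTopology Λ] {h : ℂ → ℂ}
    {z : ℂ} (hc : ContinuousAt h z) (hm : ∀ᶠ w in nhds z, h w ∈ Λ) :
    ∀ᶠ w in nhds z, h w = h z := by
  have hz : h z ∈ Λ := hm.self_of_nhds
  obtain ⟨U, hU, hUz⟩ := isOpen_induced_iff.1 (isOpen_discrete ({⟨h z, hz⟩} : Set Λ))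
  have : ∀ᶠ w in nhds z, h w ∈ U := hc.eventually (hU.mem_nhds (by
    have : (⟨h z, hz⟩ : Λ) ∈ Subtype.val ⁻¹' U := by rw [hUz]; rfl
    exact this))
  filter_upwards [hm, this] with w hw hwU
  have : (⟨h w, hw⟩ : Λ) ∈ Subtype.val ⁻¹' U := hwU
  rw [hUz] at this
  exact congrArg Subtype.val this

theorem deriv_sq_eq_of_eventually_sub_mem {Λ : Submodule ℤ ℂ} [DiscreteTopology Λ] {f g : ℂ → ℂ}
    {z : ℂ} (hf : DifferentiableAt ℂ f z) (hg : DifferentiableAt ℂ g z)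
    (h : ∀ᶠ w in nhds z, f w - g w ∈ Λ) : deriv f z ^ 2 = deriv g z ^ 2 := by
  have h0 := (eventually_eq_of_eventually_mem (h := fun w => f w - g w)
    (hf.continuousAt.sub hg.continuousAt) h)
  have h1 : deriv (fun w => f w - g w) z = 0 := by
    rw [Filter.EventuallyEq.deriv_eq (f := fun _ => f z - g z) h0, deriv_const]
  rw [deriv_fun_sub hf hg, sub_eq_zero] at h1
  rw [h1]

/-- Two liftings of the same map have the same squared derivative: away from the points where
`f - g` takes values in `Λ`, the function `f + g` does. -/
theorem deriv_sq_eq_of_proj_eq {Λ : Submodule ℤ ℂ} [DiscreteTopology Λ] {f g : ℂ → ℂ}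
    {V : Set ℂ} (hV : IsOpen V) (hf : DifferentiableOn ℂ f V) (hg : DifferentiableOn ℂ g V)
    (h : ∀ w ∈ V, proj Λ (f w) = proj Λ (g w)) {z : ℂ} (hz : z ∈ V) :
    deriv f z ^ 2 = deriv g z ^ 2 := by
  have hfa : ∀ w ∈ V, DifferentiableAt ℂ f w := fun w hw => hf.differentiableAt (hV.mem_nhds hw)
  have hga : ∀ w ∈ V, DifferentiableAt ℂ g w := fun w hw => hg.differentiableAt (hV.mem_nhds hw)
  have hout : ∀ w ∈ V, f w - g w ∉ Λ → deriv f w ^ 2 = deriv g w ^ 2 := by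
    intro w hw hn
    have h1 : ∀ᶠ y in nhds w, f y - g y ∈ (Λ : Set ℂ)ᶜ :=
      ((hfa w hw).continuousAt.sub (hga w hw).continuousAt).eventually
        ((isClosed_of_discreteTopology Λ).isOpen_compl.mem_nhds hn)
    rw [← neg_sq (deriv g w), ← deriv.fun_neg]
    refine deriv_sq_eq_of_eventually_sub_mem (Λ := Λ) (hfa w hw) (hga w hw).neg ?_
    filter_upwards [h1, hV.mem_nhds hw] with y hy hyV
    simpa using (proj_eq_proj_iff.1 (h y hyV)).resolve_left hy
  -- If the squares differ at `z`, they differ near `z` by continuity. By `hout`, `f - g` then takes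
  -- values in `Λ` near `z`, which forces equal derivatives there.
  by_contra hne
  have hcf : ContinuousAt (deriv f) z :=
    ((hf.deriv hV).differentiableAt (hV.mem_nhds hz)).continuousAt
  have hcg : ContinuousAt (deriv g) z :=
    ((hg.deriv hV).differentiableAt (hV.mem_nhds hz)).continuousAt
  have h2 : ∀ᶠ y in nhds z, deriv f y ^ 2 - deriv g y ^ 2 ≠ 0 :=
    ((hcf.pow 2).sub (hcg.pow 2)).eventually_ne (sub_ne_zero.2 hne)
  refine hne (deriv_sq_eq_of_eventually_sub_mem (Λ := Λ) (hfa z hz) (hga z hz) ?_)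
  filter_upwards [h2, hV.mem_nhds hz] with y hy hyV
  by_contra hn
  exact hy (sub_eq_zero.2 (hout y hyV hn))

theorem sq_eq_of_proj_affine_eq {Λ : Submodule ℤ ℂ} [DiscreteTopology Λ] {a b a' b' : ℂ}
    {V : Set ℂ} (hV : IsOpen V) (hne : V.Nonempty)
    (h : ∀ w ∈ V, proj Λ (a * w + b) = proj Λ (a' * w + b')) : a ^ 2 = a' ^ 2 := by
  obtain ⟨z, hz⟩ := hne
  have hd : ∀ a b : ℂ, HasDerivAt (fun w => a * w + b) a z := fun a b => by
    simpa using ((hasDerivAt_id z).const_mul a).add_const b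
  have := deriv_sq_eq_of_proj_eq hV (f := fun w => a * w + b) (g := fun w => a' * w + b')
    (by fun_prop) (by fun_prop) h hz
  rwa [(hd a b).deriv, (hd a' b').deriv] at this

/-- Two affine maps with the same linear part that agree on an open set modulo the deck group
agree everywhere. -/
theorem proj_affine_eq_of_isOpen {Λ : Submodule ℤ ℂ} [DiscreteTopology Λ] {a b b' : ℂ}
    {V : Set ℂ} (hV : IsOpen V) (hne : V.Nonempty)
    (h : ∀ w ∈ V, proj Λ (a * w + b) = proj Λ (a * w + b')) (w : ℂ) :
    proj Λ (a * w + b) = proj Λ (a * w + b') := by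
  by_cases hb : b - b' ∈ Λ
  · exact proj_eq_proj_iff.2 (Or.inl (by rwa [add_sub_add_left_eq_sub]))
  obtain ⟨z, hz⟩ := hne
  -- With `b - b' ∉ Λ` only the sign `-1` can relate the two values. A nonconstant affine function
  -- cannot take values in a discrete group on an open set, so `a = 0`.
  have hs : ∀ w ∈ V, (2 * a) * w + (b + b') ∈ Λ := by
    intro w hw
    have := (proj_eq_proj_iff.1 (h w hw)).resolve_left (by rwa [add_sub_add_left_eq_sub])
    convert this using 1
    ring
  have hd : HasDerivAt (fun w => (2 * a) * w + (b + b')) (2 * a) z := by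
    simpa using ((hasDerivAt_id z).const_mul (2 * a)).add_const (b + b')
  have hc := eventually_eq_of_eventually_mem (Λ := Λ) hd.continuousAt
    (Filter.eventually_of_mem (hV.mem_nhds hz) hs)
  have h0 := Filter.EventuallyEq.deriv_eq (f₁ := fun w => (2 * a) * w + (b + b'))
    (f := fun _ => (2 * a) * z + (b + b')) hc
  rw [deriv_const, hd.deriv] at h0
  have ha : a = 0 := by simpa using h0
  subst ha
  exact proj_eq_proj_iff.2 (Or.inr (by simpa using hs z hz))

/-! ### Holomorphic orbi-maps are affine on the universal cover -/

section Affine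

variable {Λ Λ' : Submodule ℤ ℂ} {u : Pillow Λ → Pillow Λ'}

/-- The square of the derivative of a lifting is globally defined; it is a doubly periodic
entire function, hence constant. -/
theorem exists_deriv_sq_eq [DiscreteTopology Λ] [IsZLattice ℝ Λ] [DiscreteTopology Λ']
    (F : ∀ z, LocalLift u z) : ∃ c : ℂ, ∀ z, ∀ w ∈ (F z).U, deriv (F z).f w ^ 2 = c := by
  set q : ℂ → ℂ := fun z => deriv (F z).f z ^ 2 with hq
  have hloc : ∀ z, ∀ w ∈ (F z).U, deriv (F z).f w ^ 2 = q w := by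
    intro z w hw
    refine deriv_sq_eq_of_proj_eq (Λ := Λ') ((F z).isOpen.inter (F w).isOpen)
      ((F z).holo.mono Set.inter_subset_left) ((F w).holo.mono Set.inter_subset_right) ?_
      ⟨hw, (F w).mem⟩
    rintro y ⟨hy, hy'⟩
    rw [(F z).covers y hy, (F w).covers y hy']
  have hdiff : Differentiable ℂ q := by
    intro z
    have h1 : DifferentiableAt ℂ (fun w => deriv (F z).f w ^ 2) z :=
      (((F z).holo.deriv (F z).isOpen).differentiableAt ((F z).isOpen.mem_nhds (F z).mem)).pow 2
    refine h1.congr_of_eventuallyEq ?_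
    filter_upwards [(F z).isOpen.mem_nhds (F z).mem] with w hw
    exact (hloc z w hw).symm
  have hper : ∀ z w, w ∈ Λ → q (z + w) = q z := by
    intro z v hv
    have hcont : Continuous fun w : ℂ => w + v := by fun_prop
    have hV := ((F (z + v)).isOpen.preimage hcont).inter (F z).isOpen
    have hd : DifferentiableOn ℂ (fun w => (F (z + v)).f (w + v))
        ((fun w : ℂ => w + v) ⁻¹' (F (z + v)).U ∩ (F z).U) :=
      (F (z + v)).holo.comp (f := fun w : ℂ => w + v) (by fun_prop) fun w hw => hw.1
    have := deriv_sq_eq_of_proj_eq (Λ := Λ') hV hd ((F z).holo.mono Set.inter_subset_right)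
      (by
        rintro y ⟨hy, hy'⟩
        rw [(F (z + v)).covers _ hy, (F z).covers y hy', proj_add_of_mem hv])
      ⟨(F (z + v)).mem, (F z).mem⟩
    rwa [deriv_comp_add_const] at this
  -- Periodicity makes the range compact; Liouville's theorem concludes.
  have hb := (IsZLattice.isCompact_range_of_periodic Λ q hdiff.continuous hper).isBounded
  exact ⟨q 0, fun z w hw => (hloc z w hw).trans (hdiff.apply_eq_apply_of_bounded hb w 0)⟩

/-- On the connected ball the continuous function `f'` is a square root of a constant, so it cannot
switch between `a` and `-a`. The sign is kept outside the affine map because `proj` ignores it. -/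
theorem exists_affine_of_deriv_sq_eq {f : ℂ → ℂ} {z a : ℂ} {r : ℝ} (hr : 0 < r)
    (hf : DifferentiableOn ℂ f (Metric.ball z r))
    (h : ∀ w ∈ Metric.ball z r, deriv f w ^ 2 = a ^ 2) :
    ∃ b : ℂ, (∀ w ∈ Metric.ball z r, f w = a * w + b) ∨
      ∀ w ∈ Metric.ball z r, f w = -(a * w + b) := by
  have hz := Metric.mem_ball_self (x := z) hr
  have key : ∀ g : ℂ → ℂ, DifferentiableOn ℂ g (Metric.ball z r) →
      (∀ w ∈ Metric.ball z r, deriv g w = a) →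
      ∀ w ∈ Metric.ball z r, g w = a * w + (g z - a * z) := by
    intro g hg hga w hw
    have hconst := Metric.isOpen_ball.is_const_of_deriv_eq_zero
      (f := fun w => g w - a * w) (convex_ball z r).isPreconnected (by fun_prop) (by
        intro y hy
        have h1 : HasDerivAt g a y := by
          rw [← hga y hy]
          exact (hg.differentiableAt (Metric.isOpen_ball.mem_nhds hy)).hasDerivAt
        have h2 : HasDerivAt (fun w => a * w) a y := by
          simpa using (hasDerivAt_id y).const_mul a
        have := (h1.sub h2).deriv
        rw [sub_self] at this
        exact this) hw hz
    linear_combination hconst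
  have hcont : ContinuousOn (deriv f) (Metric.ball z r) := (hf.deriv Metric.isOpen_ball).continuousOn
  have hor : (∀ w ∈ Metric.ball z r, deriv f w = a) ∨
      ∀ w ∈ Metric.ball z r, deriv f w = -a := by
    by_cases ha : a = 0
    · subst ha
      exact Or.inl fun w hw => by simpa using h w hw
    · exact (convex_ball z r).isPreconnected.eq_or_eq_neg_of_sq_eq hcont
        continuousOn_const (fun w hw => h w hw) (fun _ => ha)
  rcases hor with hor | hor
  · exact ⟨_, Or.inl (key f hf hor)⟩
  · refine ⟨-f z - a * z, Or.inr fun w hw => ?_⟩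
    rw [← key (fun w => -f w) hf.neg (fun w hw => by rw [deriv.fun_neg, hor w hw, neg_neg]) w hw,
      neg_neg]

/-- A holomorphic map of orbifolds is induced by an affine map of `ℂ`. -/
theorem IsHolomorphicOrbiMap.exists_affine [DiscreteTopology Λ] [IsZLattice ℝ Λ]
    [DiscreteTopology Λ'] (hu : IsHolomorphicOrbiMap u) :
    ∃ a b : ℂ, ∀ w, u (proj Λ w) = proj Λ' (a * w + b) := by
  obtain ⟨c, hc⟩ := exists_deriv_sq_eq fun z => (hu z).some
  obtain ⟨a, ha⟩ := IsAlgClosed.exists_pow_nat_eq c two_pos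
  have hloc : ∀ z, ∃ r > 0, ∃ b, ∀ w ∈ Metric.ball z r, u (proj Λ w) = proj Λ' (a * w + b) := by
    intro z
    set F := (hu z).some
    obtain ⟨r, hr, hrU⟩ := Metric.isOpen_iff.1 F.isOpen z F.mem
    obtain ⟨b, hb⟩ := exists_affine_of_deriv_sq_eq hr (F.holo.mono hrU)
      (fun w hw => by rw [ha, hc z w (hrU hw)])
    refine ⟨r, hr, b, fun w hw => ?_⟩
    rw [← F.covers w (hrU hw)]
    rcases hb with hb | hb
    · rw [hb w hw]
    · rw [hb w hw, proj_neg]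
  choose r hr b hb using hloc
  refine ⟨a, b 0, ?_⟩
  -- The local constants `b z` are compared with `b 0` by connectedness of `ℂ`: the set where the
  -- formula with `b 0` holds locally is clopen and contains `0`.
  set S : Set ℂ := {z | ∀ᶠ w in nhds z, u (proj Λ w) = proj Λ' (a * w + b 0)} with hS
  have hopen : IsOpen S := isOpen_iff_mem_nhds.2 fun z hz => eventually_eventually_nhds.2 hz
  have hclosed : IsClosed S := by
    refine isClosed_of_closure_subset fun z hz => ?_
    obtain ⟨y, hy, hyS⟩ := mem_closure_iff.1 hz _ Metric.isOpen_ball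
      (Metric.mem_ball_self (hr z))
    obtain ⟨V, hV, hVo, hyV⟩ := eventually_nhds_iff.1
      (Filter.Eventually.and hyS (Metric.isOpen_ball.mem_nhds hy))
    have heq := proj_affine_eq_of_isOpen hVo ⟨y, hyV⟩ (a := a) (b := b z) (b' := b 0)
      (fun w hw => (hb z w (hV w hw).2).symm.trans (hV w hw).1)
    exact Filter.eventually_of_mem (Metric.ball_mem_nhds z (hr z))
      fun w hw => (hb z w hw).trans (heq w)
  have huniv : S = Set.univ := IsClopen.eq_univ ⟨hclosed, hopen⟩
    ⟨0, Filter.eventually_of_mem (Metric.ball_mem_nhds 0 (hr 0)) (hb 0)⟩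
  intro w
  have hw : w ∈ S := huniv ▸ Set.mem_univ w
  exact hw.self_of_nhds

end Affine

/-! ### Maps induced by multiplication by a scalar -/

section Scale

variable {Λ Λ' : Submodule ℤ ℂ}

/-- The map of quotients induced by `w ↦ c w`. It satisfies `scale_proj` when `c Λ ⊆ Λ'`. -/
noncomputable def scale (Λ Λ' : Submodule ℤ ℂ) (c : ℂ) (p : Pillow Λ) : Pillow Λ' :=
  proj Λ' (c * (proj_surjective Λ p).choose)

theorem scale_proj {c : ℂ} (h : ∀ v ∈ Λ, c * v ∈ Λ') (w : ℂ) :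
    scale Λ Λ' c (proj Λ w) = proj Λ' (c * w) := by
  rw [scale, proj_eq_proj_iff, ← mul_sub, ← mul_add]
  exact (proj_eq_proj_iff.1 (proj_surjective Λ (proj Λ w)).choose_spec).imp (h _) (h _)

theorem mul_mem_of_proj_eq {u : Pillow Λ → Pillow Λ'} {c : ℂ}
    (h : ∀ w, u (proj Λ w) = proj Λ' (c * w)) {v : ℂ} (hv : v ∈ Λ) : c * v ∈ Λ' := by
  rw [← proj_eq_proj_zero_iff, ← h, proj_eq_proj_zero_iff.2 hv, h, mul_zero]

/-- Conjugation of deck transformations by `w ↦ c w`. -/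
noncomputable def deckConj {c : ℂ} (hc : c ≠ 0) (h : ∀ v ∈ Λ, c * v ∈ Λ') :
    deckGroup Λ →* deckGroup Λ' :=
  ((MulAut.conj (Equiv.mulLeft₀ c hc)).toMonoidHom.comp (deckGroup Λ).subtype).codRestrict
    (deckGroup Λ') (by
      rintro ⟨g, ε, v, hv, hg⟩
      refine ⟨ε, c * v, h v hv, fun w => ?_⟩
      change c * g (c⁻¹ * w) = _
      rw [hg, mul_add, mul_smul_comm, mul_inv_cancel_left₀ hc])

theorem deckConj_smul_mul {c : ℂ} (hc : c ≠ 0) (h : ∀ v ∈ Λ, c * v ∈ Λ') (g : deckGroup Λ) (w : ℂ) :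
    deckConj hc h g • (c * w) = c * g • w := by
  change c * g.1 (c⁻¹ * (c * w)) = c * g.1 w
  rw [inv_mul_cancel_left₀ hc]

/-- The isotropy homomorphism of the lifting `w ↦ c w`. -/
noncomputable def isotropyConj {c : ℂ} (hc : c ≠ 0) (h : ∀ v ∈ Λ, c * v ∈ Λ') (z : ℂ) :
    isotropy Λ z →* isotropy Λ' (c * z) :=
  ((deckConj hc h).comp (isotropy Λ z).subtype).codRestrict (isotropy Λ' (c * z)) fun g => by
    change deckConj hc h g.1 • (c * z) = c * z
    rw [deckConj_smul_mul, g.2]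

theorem isotropyConj_injective {c : ℂ} (hc : c ≠ 0) (h : ∀ v ∈ Λ, c * v ∈ Λ') (z : ℂ) :
    Function.Injective (isotropyConj hc h z) := by
  intro g g' hg
  refine Subtype.ext (Subtype.ext ?_)
  exact (MulAut.conj (Equiv.mulLeft₀ c hc)).injective
    (congrArg (fun k : isotropy Λ' (c * z) => k.1.1) hg)

/-- The only possible nontrivial isotropy at `c z` is the point reflection there. It is the
conjugate of the reflection about `z`, which is a deck transformation exactly because `2 z ∈ Λ`. -/
theorem isotropyConj_surjective {c : ℂ} (hc : c ≠ 0) (h : ∀ v ∈ Λ, c * v ∈ Λ') {z : ℂ}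
    (hz : 2 * z ∈ Λ) : Function.Surjective (isotropyConj hc h z) := by
  rintro ⟨⟨g, ε, v, hv, hg⟩, hfix⟩
  have hfix' : g (c * z) = c * z := hfix
  rw [hg] at hfix'
  rcases Int.units_eq_one_or ε with rfl | rfl
  · refine ⟨1, ?_⟩
    rw [map_one]
    refine Subtype.ext (Subtype.ext (Equiv.ext fun w => ?_))
    have hv0 : v = 0 := by simpa using hfix'
    change w = g w
    rw [hg, hv0]
    simp
  · have hv2 : v = 2 * (c * z) := by
      simp only [Units.val_neg, Units.val_one, neg_smul, one_smul] at hfix'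
      linear_combination hfix'
    have hmem : Equiv.subLeft (2 * z) ∈ deckGroup Λ :=
      ⟨-1, 2 * z, hz, fun w => by simp [sub_eq_neg_add]⟩
    refine ⟨⟨⟨Equiv.subLeft (2 * z), hmem⟩, ?_⟩, ?_⟩
    · change 2 * z - z = z
      ring
    · refine Subtype.ext (Subtype.ext (Equiv.ext fun w => ?_))
      change c * (2 * z - c⁻¹ * w) = g w
      rw [hg, hv2, mul_sub, mul_inv_cancel_left₀ hc]
      simp only [Units.val_neg, Units.val_one, neg_smul, one_smul]
      ring

/-- The lifting `w ↦ c w`. -/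
noncomputable def linearLift {u : Pillow Λ → Pillow Λ'} {c : ℂ} (hc : c ≠ 0)
    (h : ∀ w, u (proj Λ w) = proj Λ' (c * w)) (z : ℂ) : LocalLift u z where
  U := Set.univ
  isOpen := isOpen_univ
  mem := Set.mem_univ z
  invariant := fun _ _ _ => Set.mem_univ _
  f := fun w => c * w
  holo := by fun_prop
  covers := fun w _ => (h w).symm
  ρ := isotropyConj hc (fun _ => mul_mem_of_proj_eq h) z
  equivariant := fun g w _ => (deckConj_smul_mul hc (fun _ => mul_mem_of_proj_eq h) g.1 w).symm

theorem linearLift_isIdInCharts {u : Pillow Λ → Pillow Λ'} {c : ℂ} (hc : c ≠ 0)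
    (h : ∀ w, u (proj Λ w) = proj Λ' (c * w)) {z : ℂ} (hz : 2 * z ∈ Λ) :
    (linearLift hc h z).IsIdInCharts :=
  ⟨fun _ _ _ _ hw => mul_left_cancel₀ hc hw,
    isotropyConj_injective hc _ z, isotropyConj_surjective hc _ hz⟩

theorem isHolomorphicOrbiMap_of_linear {u : Pillow Λ → Pillow Λ'} {c : ℂ} (hc : c ≠ 0)
    (h : ∀ w, u (proj Λ w) = proj Λ' (c * w)) : IsHolomorphicOrbiMap u :=
  fun z => ⟨linearLift hc h z⟩

/-- The biholomorphism induced by multiplication by `c` when `c Λ = Λ'`. -/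
noncomputable def scaleEquiv {c : ℂ} (hc : c ≠ 0) (h : ∀ v ∈ Λ, c * v ∈ Λ')
    (h' : ∀ v ∈ Λ', c⁻¹ * v ∈ Λ) : Pillow Λ ≃ Pillow Λ' where
  toFun := scale Λ Λ' c
  invFun := scale Λ' Λ c⁻¹
  left_inv p := by
    obtain ⟨w, rfl⟩ := proj_surjective Λ p
    rw [scale_proj h, scale_proj h', inv_mul_cancel_left₀ hc]
  right_inv p := by
    obtain ⟨w, rfl⟩ := proj_surjective Λ' p
    rw [scale_proj h', scale_proj h, mul_inv_cancel_left₀ hc]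

theorem scaleEquiv_isBiholomorphism {c : ℂ} (hc : c ≠ 0) (h : ∀ v ∈ Λ, c * v ∈ Λ')
    (h' : ∀ v ∈ Λ', c⁻¹ * v ∈ Λ) : IsBiholomorphism (scaleEquiv hc h h') :=
  ⟨isHolomorphicOrbiMap_of_linear hc (scale_proj h),
    isHolomorphicOrbiMap_of_linear (inv_ne_zero hc) (scale_proj h')⟩

end Scale

/-! ### Orbifold points -/

/-- Representatives of `ℤ² / 2 ℤ²`. -/
def bits : Fin 4 → Fin 2 → ℤ := ![![0, 0], ![1, 0], ![1, 1], ![0, 1]]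

theorem bits_injective_mod_two :
    ∀ i i' : Fin 4, (∀ j, (2 : ℤ) ∣ bits i j - bits i' j) → i = i' := by
  decide

theorem exists_bits (m : Fin 2 → ℤ) : ∃ i, ∀ j, (2 : ℤ) ∣ m j - bits i j := by
  simp only [Fin.forall_fin_two]
  rcases Int.emod_two_eq (m 0) with h0 | h0 <;> rcases Int.emod_two_eq (m 1) with h1 | h1
  · exact ⟨0, by simp [bits]; omega⟩
  · exact ⟨3, by simp [bits]; omega⟩
  · exact ⟨1, by simp [bits]; omega⟩
  · exact ⟨2, by simp [bits]; omega⟩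

section HalfPoints

variable {Λ : Submodule ℤ ℂ} (b : Module.Basis (Fin 2) ℤ Λ)

/-- The orbifold points in terms of a basis of the lattice. -/
noncomputable def halfPoint (i : Fin 4) : Pillow Λ :=
  proj Λ ((b.equivFun.symm (bits i) : Λ) / 2)

theorem halfPoint_zero : halfPoint b 0 = proj Λ 0 := by
  have : bits 0 = 0 := by decide
  rw [halfPoint, this, map_zero, Submodule.coe_zero, zero_div]

theorem halfPoint_injective : Function.Injective (halfPoint b) := by
  intro i i' h
  refine bits_injective_mod_two i i' ?_
  obtain ⟨p, hp⟩ : ∃ p, p = b.equivFun.symm (bits i) := ⟨_, rfl⟩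
  obtain ⟨q, hq⟩ : ∃ q, q = b.equivFun.symm (bits i') := ⟨_, rfl⟩
  rw [halfPoint, halfPoint, ← hp, ← hq] at h
  -- The sign is harmless: `(p + q) / 2` and `(p - q) / 2` differ by `q ∈ Λ`.
  have hmem : ((p : ℂ) - q) / 2 ∈ Λ := by
    rcases proj_eq_proj_iff.1 h with h | h
    · rwa [sub_div]
    · convert Λ.sub_mem h q.2 using 1
      ring
  have h2 : p - q = (2 : ℤ) • (⟨_, hmem⟩ : Λ) := by
    refine Subtype.ext ?_
    simp only [Submodule.coe_sub, Submodule.coe_smul, zsmul_eq_mul]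
    push_cast
    ring
  intro j
  have h3 := congrFun (congrArg b.equivFun h2) j
  rw [map_sub, map_smul, (LinearEquiv.eq_symm_apply _).1 hp, (LinearEquiv.eq_symm_apply _).1 hq] at h3
  exact ⟨_, h3⟩

theorem exists_halfPoint_eq {w : ℂ} (hw : 2 * w ∈ Λ) : ∃ i, proj Λ w = halfPoint b i := by
  obtain ⟨i, hi⟩ := exists_bits (b.equivFun ⟨2 * w, hw⟩)
  choose k hk using hi
  refine ⟨i, proj_eq_proj_iff.2 (Or.inl ?_)⟩
  have h1 : (⟨2 * w, hw⟩ : Λ) = b.equivFun.symm (bits i) + (2 : ℤ) • b.equivFun.symm k := by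
    rw [← map_smul, ← map_add, LinearEquiv.eq_symm_apply]
    funext j
    rw [Pi.add_apply, Pi.smul_apply, smul_eq_mul, ← hk j]
    ring
  have h2 := congrArg Subtype.val h1
  simp only [Submodule.coe_add, Submodule.coe_smul, zsmul_eq_mul] at h2
  push_cast at h2
  convert (b.equivFun.symm k).2 using 1
  linear_combination h2 / 2

theorem range_halfPoint : Set.range (halfPoint b) = proj Λ '' {w | 2 * w ∈ Λ} := by
  ext p
  constructor
  · rintro ⟨i, rfl⟩
    exact ⟨_, by
      change 2 * (_ / 2) ∈ Λ
      rw [mul_div_cancel₀ _ two_ne_zero]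
      exact Subtype.mem _, rfl⟩
  · rintro ⟨w, hw, rfl⟩
    obtain ⟨i, hi⟩ := exists_halfPoint_eq b hw
    exact ⟨i, hi.symm⟩

end HalfPoints

theorem finite_orbifoldPoints {Λ : Submodule ℤ ℂ} (b : Module.Basis (Fin 2) ℤ Λ) :
    (proj Λ '' {w | 2 * w ∈ Λ}).Finite :=
  range_halfPoint b ▸ Set.finite_range _

/-- Fibres of `proj` are countable and `ℂ` is not. This provides points outside the finite
exceptional sets in the definition of degree. -/
theorem infinite_pillow (Λ : Submodule ℤ ℂ) [Countable Λ] : Infinite (Pillow Λ) := by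
  by_contra hfin
  rw [not_infinite_iff_finite] at hfin
  have : (Set.univ : Set ℂ).Countable := by
    have hfib : ∀ p : Pillow Λ, (proj Λ ⁻¹' {p}).Countable := by
      intro p
      obtain ⟨t, rfl⟩ := proj_surjective Λ p
      refine ((Set.countable_range fun v : Λ => (v : ℂ) + t).union
        (Set.countable_range fun v : Λ => (v : ℂ) - t)).mono ?_
      intro w hw
      rcases proj_eq_proj_iff.1 hw with h | h
      · exact Or.inl ⟨⟨_, h⟩, by simp⟩
      · exact Or.inr ⟨⟨_, h⟩, by simp⟩
    refine (Set.countable_iUnion hfib).mono fun w _ => ?_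
    exact Set.mem_iUnion.2 ⟨proj Λ w, rfl⟩
  exact not_countable_complex this

/-! ### The degree -/

section Degree

variable {Λ Λ' : Submodule ℤ ℂ} {u : Pillow Λ → Pillow Λ'}

/-- The fibre consists of the classes `[t + v]` with `v ∈ Λ'` modulo `Λ`. An identification of two
of them through `-1` would put `2 t` in `Λ'`, so away from the orbifold points there is none. -/
theorem encard_fiber (hle : Λ ≤ Λ') (hu : ∀ w, u (proj Λ w) = proj Λ' w) {t : ℂ}
    (ht : 2 * t ∉ Λ') :
    (u ⁻¹' {proj Λ' t}).encard = ENat.card (Λ' ⧸ Λ.submoduleOf Λ') := by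
  let f : (Λ' ⧸ Λ.submoduleOf Λ') → Pillow Λ := fun q => proj Λ (t + (Quotient.out q : Λ'))
  have hf : Function.Injective f := by
    intro q q' h
    rcases proj_eq_proj_iff.1 h with h | h
    · rw [add_sub_add_left_eq_sub] at h
      rw [← Submodule.Quotient.mk_out q, ← Submodule.Quotient.mk_out q', Submodule.Quotient.eq]
      exact h
    · refine absurd ?_ ht
      convert Λ'.sub_mem (Λ'.sub_mem (hle h) (Quotient.out q).2) (Quotient.out q').2 using 1
      ring
  have hr : Set.range f = u ⁻¹' {proj Λ' t} := by
    have hmem : ∀ v ∈ Λ', proj Λ (t + v) ∈ Set.range f := by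
      intro v hv
      refine ⟨Submodule.Quotient.mk ⟨v, hv⟩, proj_eq_proj_iff.2 (Or.inl ?_)⟩
      rw [add_sub_add_left_eq_sub]
      exact (Submodule.Quotient.eq (Λ.submoduleOf Λ')).1 (Submodule.Quotient.mk_out
        (Submodule.Quotient.mk (p := Λ.submoduleOf Λ') ⟨v, hv⟩))
    refine Set.Subset.antisymm ?_ fun p hp => ?_
    · rintro _ ⟨q, rfl⟩
      change u (proj Λ _) = _
      rw [hu, proj_add_of_mem (Subtype.mem _)]
    · obtain ⟨w, rfl⟩ := proj_surjective Λ p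
      have hp' : u (proj Λ w) = proj Λ' t := hp
      rw [hu] at hp'
      rcases proj_eq_proj_iff.1 hp' with h | h
      · simpa using hmem _ h
      · rw [← proj_neg]
        simpa using hmem _ (Λ'.neg_mem h)
  rw [← hr, ← Set.image_univ, hf.encard_image, Set.encard_univ]

theorem hasDegree_iff (b : Module.Basis (Fin 2) ℤ Λ') [Countable Λ'] (hle : Λ ≤ Λ')
    (hu : ∀ w, u (proj Λ w) = proj Λ' w) {d : ℕ} (hd : 1 ≤ d) :
    HasDegree u d ↔ Nat.card (Λ' ⧸ Λ.submoduleOf Λ') = d := by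
  have hfin := finite_orbifoldPoints b
  constructor
  · intro h
    have := infinite_pillow Λ'
    obtain ⟨y, hy⟩ := (h.union hfin).exists_notMem
    obtain ⟨t, rfl⟩ := proj_surjective Λ' y
    rw [Set.mem_union, not_or] at hy
    have h1 : (u ⁻¹' {proj Λ' t}).encard = (d : ℕ∞) := not_not.1 hy.1
    rw [encard_fiber hle hu fun ht => hy.2 ⟨t, ht, rfl⟩] at h1
    rw [Nat.card, ← ENat.toNat_natCast d, ← h1]
    rfl
  · intro h
    -- `Nat.card` is `0` on infinite types, so `d ≥ 1` rules out infinite index.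
    have : Finite (Λ' ⧸ Λ.submoduleOf Λ') := Nat.finite_of_card_ne_zero (by omega)
    refine hfin.subset fun y hy => ?_
    obtain ⟨t, rfl⟩ := proj_surjective Λ' y
    by_contra hn
    refine hy ?_
    rw [encard_fiber hle hu fun ht => hn ⟨t, ht, rfl⟩, ENat.card_eq_coe_natCard, h]

theorem not_hasDegree_const [Countable Λ'] {y : Pillow Λ'} (hu : ∀ p, u p = y) {d : ℕ}
    (hd : 1 ≤ d) : ¬ HasDegree u d := by
  intro h
  have := infinite_pillow Λ'
  obtain ⟨y', hy'⟩ := (h.union (Set.finite_singleton y)).exists_notMem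
  rw [Set.mem_union, not_or] at hy'
  have h1 : (u ⁻¹' {y'}).encard = (d : ℕ∞) := not_not.1 hy'.1
  have h2 : u ⁻¹' {y'} = ∅ := Set.eq_empty_of_forall_notMem fun p hp =>
    hy'.2 ((show u p = y' from hp).symm.trans (hu p))
  rw [h2, Set.encard_empty] at h1
  have : (d : ℕ∞) = (0 : ℕ) := h1.symm
  have := Nat.cast_inj.1 this
  omega

end Degree

theorem HasDegree.comp_equiv {Λ Λ' Λ'' : Submodule ℤ ℂ} {u : Pillow Λ' → Pillow Λ''} {d : ℕ}
    (φ : Pillow Λ ≃ Pillow Λ') (h : HasDegree (u ∘ φ) d) : HasDegree u d := by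
  refine h.subset fun y hy => ?_
  change ((u ∘ φ) ⁻¹' {y}).encard ≠ d
  rwa [Set.preimage_comp, ← Equiv.image_symm_eq_preimage, φ.symm.injective.encard_image]

/-! ### The target -/

instance : DiscreteTopology stdLattice := by
  rw [stdLattice_eq]
  infer_instance

instance : IsZLattice ℝ stdLattice where
  span_top := by
    rw [stdLattice_eq]
    exact IsZLattice.span_top

theorem coe_stdBasis (i : Fin 2) : (stdBasis i : ℂ) = ![1, Complex.I] i := by
  rw [stdBasis, Module.Basis.map_apply, LinearEquiv.coe_ofEq_apply,
    Module.Basis.restrictScalars_apply, Complex.coe_basisOneI]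

theorem x_eq_halfPoint (i : Fin 4) : x i = halfPoint stdBasis i := by
  have h : ∀ k : Fin 2 → ℤ, ((stdBasis.equivFun.symm k : stdLattice) : ℂ) = k 0 + k 1 * Complex.I := by
    intro k
    rw [Module.Basis.equivFun_symm_apply, Fin.sum_univ_two]
    simp [coe_stdBasis]
  rw [halfPoint, h]
  fin_cases i <;> simp [x, bits]

theorem x_zero : x 0 = proj stdLattice 0 := by rw [x_eq_halfPoint, halfPoint_zero]

theorem exists_x_eq {w : ℂ} (hw : 2 * w ∈ stdLattice) : ∃ i, proj stdLattice w = x i := by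
  simp_rw [x_eq_halfPoint]
  exact exists_halfPoint_eq stdBasis hw

/-! ### Marked maps attached to sublattices -/

theorem natCast_mul_mem {d : ℕ} {Λ : Submodule ℤ ℂ}
    (hc : Nat.card (stdLattice ⧸ Λ.submoduleOf stdLattice) = d) {v : ℂ} (hv : v ∈ stdLattice) :
    (d : ℂ) * v ∈ Λ := by
  -- Lagrange: the order of the quotient group annihilates it.
  have h := card_nsmul_eq_zero' (x := Submodule.Quotient.mk (p := Λ.submoduleOf stdLattice) ⟨v, hv⟩)
  rw [hc, ← Submodule.Quotient.mk_smul, Submodule.Quotient.mk_eq_zero] at h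
  rw [← nsmul_eq_mul]
  exact h

theorem discreteTopology_of_mem_sublattices {d : ℕ} {Λ : Submodule ℤ ℂ} (h : Λ ∈ sublattices d) :
    DiscreteTopology Λ :=
  DiscreteTopology.of_subset (inferInstanceAs (DiscreteTopology stdLattice)) h.1

theorem isZLattice_of_mem_sublattices {d : ℕ} (hd : 1 ≤ d) {Λ : Submodule ℤ ℂ}
    [DiscreteTopology Λ] (h : Λ ∈ sublattices d) : IsZLattice ℝ Λ where
  span_top := by
    rw [eq_top_iff, ← IsZLattice.span_top (K := ℝ) (L := stdLattice), Submodule.span_le]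
    intro v hv
    have h1 := Submodule.smul_mem (Submodule.span ℝ (Λ : Set ℂ)) ((d : ℝ)⁻¹)
      (Submodule.subset_span (natCast_mul_mem h.2.2 hv))
    have hd' : (d : ℂ) ≠ 0 := by exact_mod_cast (by omega : d ≠ 0)
    rw [Complex.real_smul] at h1
    push_cast at h1
    rwa [inv_mul_cancel_left₀ hd'] at h1

/-- A sublattice of index `d ≥ 1` as a lattice in `ℂ`. -/
abbrev toComplexLattice {d : ℕ} (hd : 1 ≤ d) (Λ : sublattices d) : ComplexLattice :=
  have := discreteTopology_of_mem_sublattices Λ.2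
  have := isZLattice_of_mem_sublattices hd Λ.2
  ⟨Λ.1⟩

noncomputable def sublatticeBasis {d : ℕ} (Λ : sublattices d) :
    Module.Basis (Fin 2) ℤ Λ.1 :=
  have := discreteTopology_of_mem_sublattices Λ.2
  have : Module.Free ℤ Λ.1 := instModuleFree_of_discrete_submodule Λ.1
  have : Module.Finite ℤ Λ.1 := instModuleFinite_of_discrete_submodule Λ.1
  Module.finBasisOfFinrankEq ℤ Λ.1 Λ.2.2.1

/-- Orderings of the four orbifold points of the domain that start with `[0]`. -/
abbrev Ordering : Type := {σ : Equiv.Perm (Fin 4) // σ 0 = 0}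

theorem card_ordering : Nat.card Ordering = 6 := by
  rw [Nat.card_eq_fintype_card]
  decide

/-- The marked map induced by the identity of `ℂ`. -/
noncomputable def sphere {d : ℕ} (hd : 1 ≤ d) (p : sublattices d × Ordering) : MarkedMap where
  L := toComplexLattice hd p.1
  u := scale p.1.1 stdLattice 1
  z := halfPoint (sublatticeBasis p.1) ∘ p.2.1

theorem scale_one_proj {Λ Λ' : Submodule ℤ ℂ} (h : Λ ≤ Λ') (w : ℂ) :
    scale Λ Λ' 1 (proj Λ w) = proj Λ' w := by
  rw [scale_proj fun v hv => by rw [one_mul]; exact h hv, one_mul]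

theorem exists_sphere_mem_orbiSpheres {d : ℕ} (hd : 1 ≤ d) (p : sublattices d × Ordering) :
    ∃ j k l, sphere hd p ∈ orbiSpheres d ![0, j, k, l] := by
  have hu := scale_one_proj p.1.2.1
  have hu1 : ∀ w, scale p.1.1 stdLattice 1 (proj p.1.1 w) = proj stdLattice (1 * w) := fun w => by
    rw [one_mul, hu]
  have hrange : Set.range (sphere hd p).z = proj p.1.1 '' {w | 2 * w ∈ p.1.1} := by
    rw [← range_halfPoint (sublatticeBasis p.1)]
    exact p.2.1.surjective.range_comp (halfPoint (sublatticeBasis p.1))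
  have hz0 : (sphere hd p).z 0 = proj p.1.1 0 := by
    change halfPoint _ (p.2.1 0) = _
    rw [p.2.2, halfPoint_zero]
  have hx : ∀ i, ∃ j, (sphere hd p).u ((sphere hd p).z i) = x j := by
    intro i
    obtain ⟨w, hw, hwz⟩ := hrange.subset ⟨i, rfl⟩
    rw [← hwz]
    change ∃ j, scale p.1.1 stdLattice 1 (proj p.1.1 w) = x j
    rw [hu]
    exact exists_x_eq (p.1.2.1 hw)
  choose a ha using hx
  refine ⟨a 1, a 2, a 3, isHolomorphicOrbiMap_of_linear one_ne_zero hu1, ?_, hrange, hz0, ?_, ?_⟩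
  · exact (hasDegree_iff stdBasis p.1.2.1 hu hd).2 p.1.2.2.2
  · intro i
    fin_cases i
    · change scale p.1.1 stdLattice 1 ((sphere hd p).z 0) = x 0
      rw [hz0, hu, x_zero]
    · exact ha 1
    · exact ha 2
    · exact ha 3
  · intro i w hw
    have hmem : (sphere hd p).z i ∈ proj p.1.1 '' {w | 2 * w ∈ p.1.1} := hrange ▸ ⟨i, rfl⟩
    obtain ⟨t, ht, htz⟩ := hmem
    refine ⟨linearLift one_ne_zero hu1 w, linearLift_isIdInCharts one_ne_zero hu1 ?_⟩
    -- Since `w ≡ ± t` modulo the lattice, `2 w` lies in the lattice along with `2 t`.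
    have ht' : 2 * t ∈ p.1.1 := ht
    rcases proj_eq_proj_iff.1 (hw.trans htz.symm) with h | h
    · convert p.1.1.add_mem (p.1.1.add_mem h h) ht' using 1
      ring
    · convert p.1.1.sub_mem (p.1.1.add_mem h h) ht' using 1
      ring

/-- This is the normalization: multiplication by the linear coefficient `c` carries `Λ` onto `Λ₁ = c
Λ ≤ Λ₀`, and over it the map becomes the identity of `ℂ`. -/
theorem exists_equiv_sphere {d : ℕ} (hd : 1 ≤ d) {a : Fin 4 → Fin 4} (ha : a 0 = 0)
    {A : MarkedMap} (hA : A ∈ orbiSpheres d a) :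
    ∃ p : sublattices d × Ordering, MarkedMap.setoid A (sphere hd p) := by
  obtain ⟨⟨Λ⟩, u, z⟩ := A
  rename_i hdisc hlat
  obtain ⟨hol, hdeg, hrange, hz0, hux, -⟩ := hA
  dsimp only at u z hol hdeg hrange hz0 hux
  obtain ⟨c, b, hcb⟩ := hol.exists_affine
  have hb : b ∈ stdLattice := by
    have := hcb 0
    rw [← hz0, hux, ha, x_zero, mul_zero, zero_add, eq_comm, proj_eq_proj_zero_iff] at this
    exact this
  have hc : ∀ w, u (proj Λ w) = proj stdLattice (c * w) := fun w => by
    rw [hcb, proj_add_of_mem hb]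
  have hc0 : c ≠ 0 := by
    rintro rfl
    refine not_hasDegree_const (y := proj stdLattice 0) (fun p => ?_) hd hdeg
    obtain ⟨w, rfl⟩ := proj_surjective Λ p
    rw [hc, zero_mul]
  have hcmem := fun v (hv : v ∈ Λ) => mul_mem_of_proj_eq hc hv
  let m : ℂ ≃ₗ[ℤ] ℂ := (LinearEquiv.smulOfNeZero ℂ ℂ c hc0).restrictScalars ℤ
  set Λ₁ : Submodule ℤ ℂ := Λ.map m.toLinearMap with hΛ₁
  have h1 : ∀ v ∈ Λ, c * v ∈ Λ₁ := fun v hv => ⟨v, hv, rfl⟩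
  have h2 : ∀ v ∈ Λ₁, c⁻¹ * v ∈ Λ := by
    rintro _ ⟨v, hv, rfl⟩
    change c⁻¹ * (c * v) ∈ Λ
    rwa [inv_mul_cancel_left₀ hc0]
  have hle : Λ₁ ≤ stdLattice := by
    rintro _ ⟨v, hv, rfl⟩
    exact hcmem v hv
  let φ := scaleEquiv hc0 h1 h2
  have hφ : ∀ w, φ (proj Λ w) = proj Λ₁ (c * w) := scale_proj h1
  have hu : u = scale Λ₁ stdLattice 1 ∘ φ := by
    funext p
    obtain ⟨w, rfl⟩ := proj_surjective Λ p
    rw [Function.comp_apply, hφ, scale_one_proj hle, hc]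
  have hcard := (hasDegree_iff stdBasis hle (scale_one_proj hle) hd).1
    (HasDegree.comp_equiv φ (hu ▸ hdeg))
  have hrank : Module.finrank ℤ Λ₁ = 2 := by
    rw [hΛ₁, LinearEquiv.finrank_map_eq, ZLattice.rank ℝ, Complex.finrank_real_complex]
  let Λ₂ : sublattices d := ⟨Λ₁, hle, hrank, hcard⟩
  let e := halfPoint (sublatticeBasis Λ₂)
  have he : Set.range e = Set.range (φ ∘ z) := by
    rw [Set.range_comp, hrange]
    refine (range_halfPoint _).trans ?_
    ext q
    constructor
    · rintro ⟨w, hw, rfl⟩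
      refine ⟨_, ⟨c⁻¹ * w, ?_, rfl⟩, ?_⟩
      · change 2 * (c⁻¹ * w) ∈ Λ
        rw [mul_left_comm]
        exact h2 _ hw
      · rw [hφ, mul_inv_cancel_left₀ hc0]
    · rintro ⟨_, ⟨w, hw, rfl⟩, rfl⟩
      refine ⟨c * w, ?_, (hφ w).symm⟩
      change 2 * (c * w) ∈ Λ₁
      rw [mul_left_comm]
      exact h1 _ hw
  -- The marked points, transported by `φ`, exhaust the half-points of `Λ₁`; the resulting
  -- relabelling is a permutation fixing `0`.
  have hτ : ∀ i, ∃ k, e k = φ (z i) := fun i => he.symm.subset ⟨i, rfl⟩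
  choose τ hτ using hτ
  have hτs : Function.Surjective τ := by
    intro k
    obtain ⟨i, hi⟩ := he.subset ⟨k, rfl⟩
    exact ⟨i, halfPoint_injective _ ((hτ i).trans hi)⟩
  have hτ0 : τ 0 = 0 := by
    refine halfPoint_injective (sublatticeBasis Λ₂) ((hτ 0).trans ?_)
    rw [hz0, hφ, mul_zero, halfPoint_zero]
  refine ⟨⟨Λ₂, ⟨Equiv.ofBijective τ (Finite.surjective_iff_bijective.1 hτs), hτ0⟩⟩, φ,
    scaleEquiv_isBiholomorphism hc0 h1 h2, hu, fun i => (hτ i).symm⟩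

/-- A biholomorphism over the target that fixes `[0]` is induced by the identity of `ℂ`. -/
theorem equiv_proj_eq_of_comp_eq {Λ Λ' : Submodule ℤ ℂ} [DiscreteTopology Λ] [IsZLattice ℝ Λ]
    [DiscreteTopology Λ'] (hΛ : Λ ≤ stdLattice) (hΛ' : Λ' ≤ stdLattice)
    {φ : Pillow Λ ≃ Pillow Λ'} (hφ : IsBiholomorphism φ)
    (hu : scale Λ stdLattice 1 = scale Λ' stdLattice 1 ∘ φ) (h0 : φ (proj Λ 0) = proj Λ' 0)
    (w : ℂ) : φ (proj Λ w) = proj Λ' w := by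
  obtain ⟨c, b, hcb⟩ := hφ.1.exists_affine
  have hb : b ∈ Λ' := by
    rw [← proj_eq_proj_zero_iff, ← h0, hcb, mul_zero, zero_add]
  -- Composed with the maps to the target, `φ` says that `w` and `c w` have the same image there, so
  -- `c = ± 1`.
  have hsq : (1 : ℂ) ^ 2 = c ^ 2 := by
    refine sq_eq_of_proj_affine_eq (Λ := stdLattice) (b := 0) (b' := 0) isOpen_univ
      Set.univ_nonempty fun w _ => ?_
    have := congrFun hu (proj Λ w)
    rw [Function.comp_apply, scale_one_proj hΛ, hcb, scale_one_proj hΛ',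
      proj_add_of_mem (hΛ' hb)] at this
    rw [one_mul, add_zero, add_zero, this]
  rw [hcb, proj_add_of_mem hb]
  rcases sq_eq_sq_iff_eq_or_eq_neg.1 hsq.symm with rfl | rfl
  · rw [one_mul]
  · rw [neg_mul, one_mul, proj_neg]

theorem sphere_injective {d : ℕ} (hd : 1 ≤ d) :
    Function.Injective fun p : sublattices d × Ordering =>
      Quotient.mk MarkedMap.setoid (sphere hd p) := by
  rintro ⟨⟨Λ, hΛ⟩, σ⟩ ⟨⟨Λ', hΛ'⟩, σ'⟩ h
  obtain ⟨φ, hφ, hu, hz⟩ := Quotient.exact h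
  have hdisc := discreteTopology_of_mem_sublattices hΛ
  have hlat := isZLattice_of_mem_sublattices hd hΛ
  have hdisc' := discreteTopology_of_mem_sublattices hΛ'
  change Pillow Λ ≃ Pillow Λ' at φ
  have h0 : φ (proj Λ 0) = proj Λ' 0 := by
    have h0 := hz 0
    change φ (halfPoint _ (σ.1 0)) = halfPoint _ (σ'.1 0) at h0
    rwa [σ.2, σ'.2, halfPoint_zero, halfPoint_zero] at h0
  have hid : ∀ w, φ (proj Λ w) = proj Λ' w := equiv_proj_eq_of_comp_eq hΛ.1 hΛ'.1 hφ hu h0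
  -- Each lattice is recovered as the preimage of `[0]` under its projection.
  obtain rfl : Λ = Λ' := by
    ext v
    rw [← proj_eq_proj_zero_iff (Λ := Λ), ← φ.injective.eq_iff, hid, hid, proj_eq_proj_zero_iff]
  have hσ : σ = σ' := by
    refine Subtype.ext (Equiv.ext fun i => ?_)
    have hi := hz i
    change φ (halfPoint (sublatticeBasis ⟨Λ, hΛ⟩) (σ.1 i)) =
      halfPoint (sublatticeBasis ⟨Λ, hΛ⟩) (σ'.1 i) at hi
    refine halfPoint_injective (sublatticeBasis ⟨Λ, hΛ⟩) (Eq.trans ?_ hi)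
    exact (hid _).symm
  rw [hσ]

theorem range_sphere {d : ℕ} (hd : 1 ≤ d) :
    Set.range (fun p : sublattices d × Ordering =>
      Quotient.mk MarkedMap.setoid (sphere hd p)) = moduliOne d := by
  ext q
  simp only [moduliOne, moduli, Set.mem_iUnion]
  constructor
  · rintro ⟨p, rfl⟩
    obtain ⟨j, k, l, h⟩ := exists_sphere_mem_orbiSpheres hd p
    exact ⟨j, k, l, _, h, rfl⟩
  · rintro ⟨j, k, l, A, hA, rfl⟩
    obtain ⟨p, hp⟩ := exists_equiv_sphere hd rfl hA
    exact ⟨p, (Quotient.sound hp).symm⟩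

theorem finite_moduliOne {d : ℕ} (hd : 1 ≤ d) : (moduliOne d).Finite := by
  have : Finite (sublattices d) := finite_sublattices hd
  exact range_sphere hd ▸ Set.finite_range _

theorem ncard_moduliOne {d : ℕ} (hd : 1 ≤ d) :
    (moduliOne d).ncard = 6 * (sublattices d).ncard := by
  rw [← range_sphere hd, ← Nat.card_coe_set_eq, Nat.card_range_of_injective (sphere_injective hd),
    Nat.card_prod, card_ordering, mul_comm, Nat.card_coe_set_eq]

/-! ### Generating series -/

theorem genSeries_congr {a b : ℕ → ℕ} (h : ∀ d, 1 ≤ d → a d = b d) : genSeries a = genSeries b := by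
  ext d
  rcases Nat.eq_zero_or_pos d with rfl | hd
  · simp [genSeries]
  · simp [genSeries, h d hd]

theorem coeff_natCast_mul (n d : ℕ) (f : PowerSeries ℚ) :
    PowerSeries.coeff d ((n : PowerSeries ℚ) * f) = n * PowerSeries.coeff d f := by
  rw [← nsmul_eq_mul, map_nsmul, nsmul_eq_mul]

theorem coeff_six_mul (d : ℕ) (f : PowerSeries ℚ) :
    PowerSeries.coeff d (6 * f) = 6 * PowerSeries.coeff d f := by
  have := coeff_natCast_mul 6 d f
  rwa [Nat.cast_ofNat, Nat.cast_ofNat] at this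

theorem genSeries_six_mul (a : ℕ → ℕ) : genSeries (fun d => 6 * a d) = 6 * genSeries a := by
  ext d
  rw [coeff_six_mul]
  simp [genSeries]

theorem coeff_X_pow_mul_inv_one_sub_X_pow {n : ℕ} (hn : 0 < n) (d : ℕ) :
    PowerSeries.coeff d (PowerSeries.X ^ n * (1 - PowerSeries.X ^ n : PowerSeries ℚ)⁻¹) =
      if n ∣ d ∧ d ≠ 0 then 1 else 0 := by
  have hF : (PowerSeries.mk fun d => if n ∣ d ∧ d ≠ 0 then (1 : ℚ) else 0) =
      PowerSeries.X ^ n * (1 - PowerSeries.X ^ n)⁻¹ := by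
    -- For `n > 0` the constant term of `1 - X ^ n` is `1`, so the inverse is a genuine one.
    rw [PowerSeries.eq_mul_inv_iff_mul_eq (by simp [hn.ne'])]
    ext d
    rw [mul_sub, mul_one, map_sub, PowerSeries.coeff_mk, PowerSeries.coeff_mul_X_pow',
      PowerSeries.coeff_X_pow]
    by_cases hnd : n ≤ d
    · rw [if_pos hnd, PowerSeries.coeff_mk]
      obtain ⟨k, rfl⟩ := Nat.exists_eq_add_of_le hnd
      simp_rw [Nat.add_sub_cancel_left, Nat.dvd_add_right (dvd_refl n)]
      rcases Nat.eq_zero_or_pos k with rfl | hk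
      · simp [hn.ne']
      · rw [if_neg (by omega : ¬ n + k = n)]
        simp [hk.ne', hn.ne']
    · rw [if_neg hnd, if_neg (by omega : ¬ d = n), if_neg, sub_zero]
      rintro ⟨h, h0⟩
      exact hnd (Nat.le_of_dvd (by omega) h)
  rw [← hF, PowerSeries.coeff_mk]

/-- Convergence is coefficientwise, and only the divisors `n` of `d` contribute to the coefficient
of `q ^ d`. -/
theorem hasSum_lambert : HasSum
    (fun n : ℕ+ => 6 * (((n : ℕ) : PowerSeries ℚ) * PowerSeries.X ^ (n : ℕ) *
      (1 - PowerSeries.X ^ (n : ℕ))⁻¹))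
    (6 * genSeries fun d => ArithmeticFunction.sigma 1 d) := by
  rw [PowerSeries.WithPiTopology.hasSum_iff_hasSum_coeff]
  intro d
  have hterm : ∀ n : ℕ+, PowerSeries.coeff d (6 * (((n : ℕ) : PowerSeries ℚ) *
      PowerSeries.X ^ (n : ℕ) * (1 - PowerSeries.X ^ (n : ℕ))⁻¹)) =
      6 * ((n : ℕ) * if (n : ℕ) ∣ d ∧ d ≠ 0 then (1 : ℚ) else 0) := by
    intro n
    rw [coeff_six_mul, mul_assoc, coeff_natCast_mul, coeff_X_pow_mul_inv_one_sub_X_pow n.pos]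
  simp_rw [hterm]
  rw [coeff_six_mul]
  refine HasSum.mul_left 6 ?_
  have hN : HasSum (fun n : ℕ => (n : ℚ) * if n ∣ d ∧ d ≠ 0 then (1 : ℚ) else 0)
      (∑ n ∈ d.divisors, (n : ℚ) * if n ∣ d ∧ d ≠ 0 then (1 : ℚ) else 0) :=
    hasSum_sum_of_ne_finset_zero fun n hn => by
      rw [if_neg fun h => hn (Nat.mem_divisors.2 h), mul_zero]
  have hN' : (∑ n ∈ d.divisors, (n : ℚ) * if n ∣ d ∧ d ≠ 0 then (1 : ℚ) else 0) =
      PowerSeries.coeff d (genSeries fun d => ArithmeticFunction.sigma 1 d) := by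
    rw [genSeries, PowerSeries.coeff_mk]
    rcases Nat.eq_zero_or_pos d with rfl | hd
    · simp
    · rw [if_neg hd.ne', ArithmeticFunction.sigma_one_apply, Nat.cast_sum]
      refine Finset.sum_congr rfl fun n hn => ?_
      rw [if_pos (Nat.mem_divisors.1 hn), mul_one]
  rw [hN'] at hN
  -- Passing from `ℕ` to `ℕ+` loses only `n = 0`, whose term vanishes because of the factor `n`.
  refine (Function.Injective.hasSum_iff (g := fun n : ℕ+ => (n : ℕ))
    (f := fun n : ℕ => (n : ℚ) * if n ∣ d ∧ d ≠ 0 then (1 : ℚ) else 0)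
    PNat.coe_injective fun n hn => ?_).2 hN
  have : n = 0 := by
    by_contra h0
    exact hn ⟨⟨n, Nat.pos_of_ne_zero h0⟩, rfl⟩
  rw [this, Nat.cast_zero, zero_mul]

end OrbiSphere

theorem mainTheorem1 :
    (∀ d : ℕ, 1 ≤ d →
      (OrbiSphere.moduliOne d).Finite ∧ (OrbiSphere.sublattices d).Finite ∧
        Finite (OrbiSphere.DetClasses d)) ∧
    OrbiSphere.genSeries (fun d => (OrbiSphere.moduliOne d).ncard) =
      6 * OrbiSphere.genSeries (fun d => (OrbiSphere.sublattices d).ncard) ∧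
    6 * OrbiSphere.genSeries (fun d => (OrbiSphere.sublattices d).ncard) =
      6 * OrbiSphere.genSeries (fun d => ArithmeticFunction.sigma 1 d) ∧
    HasSum
      (fun n : ℕ+ => 6 * (((n : ℕ) : PowerSeries ℚ) * PowerSeries.X ^ (n : ℕ) *
        (1 - PowerSeries.X ^ (n : ℕ))⁻¹))
      (OrbiSphere.genSeries (fun d => (OrbiSphere.moduliOne d).ncard)) ∧
    ∀ d : ℕ, 1 ≤ d →
      (OrbiSphere.moduliOne d).ncard = 6 * Nat.card (OrbiSphere.DetClasses d) := by
  have h1 : OrbiSphere.genSeries (fun d => (OrbiSphere.moduliOne d).ncard) =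
      6 * OrbiSphere.genSeries (fun d => (OrbiSphere.sublattices d).ncard) := by
    rw [← OrbiSphere.genSeries_six_mul]
    exact OrbiSphere.genSeries_congr fun d hd => OrbiSphere.ncard_moduliOne hd
  have h2 : OrbiSphere.genSeries (fun d => (OrbiSphere.sublattices d).ncard) =
      OrbiSphere.genSeries (fun d => ArithmeticFunction.sigma 1 d) :=
    OrbiSphere.genSeries_congr fun d hd =>
      (OrbiSphere.ncard_sublattices hd).trans (OrbiSphere.card_detClasses hd).2
  refine ⟨fun d hd => ⟨OrbiSphere.finite_moduliOne hd, OrbiSphere.finite_sublattices hd,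
    (OrbiSphere.card_detClasses hd).1⟩, h1, by rw [h2], ?_, fun d hd => ?_⟩
  · rw [h1, h2]
    exact OrbiSphere.hasSum_lambert
  · rw [OrbiSphere.ncard_moduliOne hd, OrbiSphere.ncard_sublattices hd]
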